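/- **Setting.** A base station with $L\ge 2$ antennas serves $L$ single-antenna mobiles. The channels $\mathbf h_1,\dots,\mathbf h_L\in\mathbb C^L$ are random vectors with i.i.d. $\mathcal{CN}(0,1)$ coefficients. Let $P>0$ be the transmission power and $\theta>0$ the SINR threshold. With $B$ feedback bits per mobile, the base station receives unit vectors $\hat{\mathbf h}_\ell$ such that, given $\mathbf h_\ell$, the vector $\hat{\mathbf h}_\ell$ is uniformly distributed on the sphere cap $\{\mathbf s\in\mathbb C^L:\|\mathbf s\|=1,\ |\mathbf s^\dagger\mathbf h_\ell|^2\ge(1-2^{-B/(L-1)})\|\mathbf h_\ell\|^2\}$, and the pairs $(\mathbf h_\ell,\hat{\mathbf h}_\ell)$, $1\le\ell\le L$, are independent. If the set $A\subseteq\{1,\dots,L\}$ of queues is scheduled, each queue $\ell\in A$ is served with power $\gamma=P/|A|$ and the zero-forcing beamforming vector $\mathbf f_\ell$ computed from the available channel vectors $\mathbf c_m$ (where $\mathbf c_m=\mathbf h_m$ for perfect feedback and $\mathbf c_m=\hat{\mathbf h}_m$ for limited feedback): the unit vector orthogonal to all $\mathbf c_m$, $m\in A\setminus\{\ell\}$,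 that maximizes $|\mathbf f_\ell^\dagger\mathbf c_\ell|$. For $\ell\in A$ the departure rate is $$\mu_\ell(A)=\Pr\big(\gamma|\mathbf f_\ell^\dagger\mathbf h_\ell|^2\ge\theta\big)\ \text{(perfect feedback)},\qquad \hat\mu_\ell(A)=\Pr\Big(\frac{\gamma|\mathbf f_\ell^\dagger\mathbf h_\ell|^2}{1+\gamma\sum_{m\in A,\,m\ne\ell}|\mathbf f_m^\dagger\mathbf h_\ell|^2}\ge\theta\Big)\ \text{(limited feedback)},$$ and $\mu_\ell(A)=\hat\mu_\ell(A)=0$ for $\ell\notin A$. For $\ell\in A$ and $|A|=k$ these rates are denoted by $d(k)$ and $\hat d(k)$. The stability region for perfect feedback is $$\mathcal C=\bigcup_{p}\Big\{\boldsymbol\lambda\in\mathbb R_{\ge0}^L:\ \lambda_\ell\le\sum_{A}p_A\,\mu_\ell(A)\ \text{ for all }\ell\Big\},$$ where $p$ ranges over the probability vectors on the $2^L$ subsets $A$ of $\{1,\dots,L\}$; the limited-feedback stability region $\hat{\mathcal C}$ is defined in the same way from $\hat\mu$. **Theorem.** Let $0<\delta<1$ and $$B(\delta)=-(L-1)\log_2\delta+\kappa,\qquad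 \kappa=(L-1)\log_2\Big(L(1+L\theta)\big(1+\tfrac{\theta}{P}\big)\Big).$$ If each mobile is given $B(\delta)$ feedback bits, or any real number $B\ge B(\delta)$ of them, then every departure-rate loss satisfies $1-\hat d(k)/d(k)\le\delta$ $(1\le k\le L)$, and $$(1-\delta)\,\mathcal C\subseteq\hat{\mathcal C}\subseteq\mathcal C .$$ -/

import Mathlib

open MeasureTheory ProbabilityTheory
open scoped Pointwise

noncomputable section

namespace SDMA

/-- The space `ℂ^L` of channel vectors and beamforming vectors, with its Hermitian norm.
The scalar `f† h` is `inner ℂ f h` (conjugate-linear in `f`). -/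
abbrev ChannelSpace (L : ℕ) : Type := EuclideanSpace ℂ (Fin L)

/-- The circularly symmetric complex Gaussian law `CN(0,1)`: independent real and imaginary parts,
each real Gaussian with mean `0` and variance `1/2`. -/
def complexGaussian : Measure ℂ :=
  ((gaussianReal 0 (1 / 2)).prod (gaussianReal 0 (1 / 2))).map
    (fun p : ℝ × ℝ => (⟨p.1, p.2⟩ : ℂ))

/-- The law on `ℂ^L` with i.i.d. `CN(0,1)` coefficients. -/
def channelLaw (L : ℕ) : Measure (ChannelSpace L) :=
  (Measure.pi fun _ : Fin L => complexGaussian).map (WithLp.toLp 2)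

/-- The surface measure of the unit sphere of `ℂ^L`, as a measure on `ℂ^L`. -/
def sphereMeasure (L : ℕ) : Measure (ChannelSpace L) :=
  (volume : Measure (ChannelSpace L)).toSphere.map Subtype.val

/-- The quantization cell of the channel `v` for `B` feedback bits: the sphere cap of unit vectors
`s` with `|s† v|² / ‖v‖² ≥ 1 - 2^(-B/(L-1))`. -/
def cap {L : ℕ} (B : ℝ) (v : ChannelSpace L) : Set (ChannelSpace L) :=
  {s | ‖s‖ = 1 ∧ (1 - (2 : ℝ) ^ (-B / ((L : ℝ) - 1))) * ‖v‖ ^ 2 ≤ ‖inner ℂ s v‖ ^ 2}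

/-- The uniform probability distribution on the cell of the channel `v`. -/
def capUniform {L : ℕ} (B : ℝ) (v : ChannelSpace L) : Measure (ChannelSpace L) :=
  cond (sphereMeasure L) (cap B v)

/-- The random channels and their quantized versions in one slot: `h ℓ` is the channel of mobile
`ℓ`, with i.i.d. `CN(0,1)` coefficients; given `h ℓ`, the fed back vector `hhat ℓ` is
uniformly distributed on the cell of `h ℓ`; the pairs `(h ℓ, hhat ℓ)` of the
different mobiles are independent. -/
structure LimitedFeedbackModel {Ω : Type*} [MeasurableSpace Ω] (μ : Measure Ω)
    [IsProbabilityMeasure μ] {L : ℕ} (B : ℝ) (h hhat : Fin L → Ω → ChannelSpace L) : Prop where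
  hasLaw : ∀ l, HasLaw (h l) (channelLaw L) μ
  aemeasurable : ∀ l, AEMeasurable (hhat l) μ
  condDistrib_eq : ∀ l, ∀ᵐ v ∂(channelLaw L), condDistrib (hhat l) (h l) μ v = capUniform B v
  indep : iIndepFun (fun l ω => (h l ω, hhat l ω)) μ

/-- The span of the vectors `c m` for scheduled `m ≠ ℓ`. -/
def interferenceSpace {L : ℕ} (A : Finset (Fin L)) (c : Fin L → ChannelSpace L) (l : Fin L) :
    Submodule ℂ (ChannelSpace L) :=
  Submodule.span ℂ {x | ∃ m ∈ A, m ≠ l ∧ c m = x}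

/-- The zero-forcing beamforming vector of queue `ℓ` computed from the channel state information
`c` when the set `A` is scheduled: the unit vector orthogonal to all `c m`, `m ∈ A`, `m ≠ ℓ`, that
maximizes `|f† (c ℓ)|` (see `zfBeam_isMax`). It is the normalized orthogonal projection of `c ℓ`. -/
def zfBeam {L : ℕ} (A : Finset (Fin L)) (c : Fin L → ChannelSpace L) (l : Fin L) :
    ChannelSpace L :=
  ((‖(interferenceSpace A c l)ᗮ.starProjection (c l)‖⁻¹ : ℝ) : ℂ) •
    (interferenceSpace A c l)ᗮ.starProjection (c l)

/-- Unless `c ℓ` lies in the span of the other scheduled vectors, `zfBeam` is a unit vector in the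
orthogonal complement of this span, with the largest gain `|f† (c ℓ)|` among all of those. -/
theorem zfBeam_isMax {L : ℕ} (A : Finset (Fin L)) (c : Fin L → ChannelSpace L) (l : Fin L)
    (hc : c l ∉ interferenceSpace A c l) :
    ‖zfBeam A c l‖ = 1 ∧ zfBeam A c l ∈ (interferenceSpace A c l)ᗮ ∧
      ∀ g ∈ (interferenceSpace A c l)ᗮ, ‖g‖ = 1 →
        ‖inner ℂ g (c l)‖ ≤ ‖inner ℂ (zfBeam A c l) (c l)‖ := by
  set W := (interferenceSpace A c l)ᗮ with hW
  set p := W.starProjection (c l) with hp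
  have hpW : p ∈ W := Submodule.starProjection_apply_mem W (c l)
  have hin : ∀ g ∈ W, inner ℂ g (c l) = inner ℂ g p := by
    intro g hg
    have h1 := Submodule.starProjection_inner_eq_zero (K := W) (c l) g hg
    have h2 : inner ℂ g (c l - p) = 0 := by
      rw [← inner_conj_symm, h1, map_zero]
    rw [inner_sub_right] at h2
    exact sub_eq_zero.mp h2
  have hp0 : p ≠ 0 := by
    intro h0
    apply hc
    have : c l ∈ Wᗮ := by
      rw [Submodule.mem_orthogonal]
      intro g hg
      rw [hin g hg, h0, inner_zero_right]
    rwa [hW, Submodule.orthogonal_orthogonal] at this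
  have hn : ‖p‖ ≠ 0 := norm_ne_zero_iff.mpr hp0
  have hz : zfBeam A c l = ((‖p‖⁻¹ : ℝ) : ℂ) • p := rfl
  refine ⟨?_, ?_, ?_⟩
  · rw [hz, norm_smul, Complex.norm_real, norm_inv, norm_norm, inv_mul_cancel₀ hn]
  · rw [hz]; exact W.smul_mem _ hpW
  · intro g hg hg1
    have hzW : zfBeam A c l ∈ W := by rw [hz]; exact W.smul_mem _ hpW
    rw [hin g hg, hin _ hzW, hz, inner_smul_left, norm_mul, RCLike.norm_conj, Complex.norm_real,
      norm_inv, norm_norm, inner_self_eq_norm_sq_to_K]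
    refine (norm_inner_le_norm g p).trans (le_of_eq ?_)
    simp only [norm_pow, RCLike.norm_ofReal, abs_norm, hg1]
    field_simp

/-- Equal power allocation: the power `γ = P / K` of each of the `K` scheduled queues. -/
def gam {L : ℕ} (P : ℝ) (A : Finset (Fin L)) : ℝ := P / (A.card : ℝ)

/-- `SNR_ℓ` for perfect feedback: the beamforming vector is computed from the true channels `h`. -/
def snr {L : ℕ} (P : ℝ) (A : Finset (Fin L)) (h : Fin L → ChannelSpace L) (l : Fin L) : ℝ :=
  gam P A * ‖inner ℂ (zfBeam A h l) (h l)‖ ^ 2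

/-- `SINR_ℓ` for limited feedback: the beamforming vectors are computed from `hhat`. -/
def sinr {L : ℕ} (P : ℝ) (A : Finset (Fin L)) (h hhat : Fin L → ChannelSpace L) (l : Fin L) : ℝ :=
  gam P A * ‖inner ℂ (zfBeam A hhat l) (h l)‖ ^ 2 /
    (1 + gam P A * ∑ m ∈ A.erase l, ‖inner ℂ (zfBeam A hhat m) (h l)‖ ^ 2)

/-- Departure rates with perfect feedback when `A` is scheduled: `Pr(SNR_ℓ ≥ θ)` for scheduled
queues, and `0` for the others. -/
def perfectRate {Ω : Type*} [MeasurableSpace Ω] (μ : Measure Ω) {L : ℕ}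
    (h : Fin L → Ω → ChannelSpace L) (P θ : ℝ) (A : Finset (Fin L)) (l : Fin L) : ℝ :=
  if l ∈ A then μ.real {ω | θ ≤ snr P A (fun m => h m ω) l} else 0

/-- Departure rates with limited feedback when `A` is scheduled: `Pr(SINR_ℓ ≥ θ)` for scheduled
queues, and `0` for the others. -/
def limitedRate {Ω : Type*} [MeasurableSpace Ω] (μ : Measure Ω) {L : ℕ}
    (h hhat : Fin L → Ω → ChannelSpace L) (P θ : ℝ) (A : Finset (Fin L)) (l : Fin L) : ℝ :=
  if l ∈ A then μ.real {ω | θ ≤ sinr P A (fun m => h m ω) (fun m => hhat m ω) l} else 0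

/-- The mean departure-rate vector of the stationary policy that schedules `A` with
probability `p A`, when `rate A` is the departure-rate vector of the decision `A`. -/
def meanRate {L : ℕ} (rate : Finset (Fin L) → Fin L → ℝ) (p : Finset (Fin L) → ℝ) : Fin L → ℝ :=
  fun l => ∑ A, p A * rate A l

/-- The stability region of the stationary policy `p`. -/
def policyRegion {L : ℕ} (rate : Finset (Fin L) → Fin L → ℝ) (p : Finset (Fin L) → ℝ) :
    Set (Fin L → ℝ) :=
  {lam | 0 ≤ lam ∧ lam ≤ meanRate rate p}

/-- The stability region: the union over all stationary policies. -/
def stabilityRegion {L : ℕ} (rate : Finset (Fin L) → Fin L → ℝ) : Set (Fin L → ℝ) :=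
  ⋃ p ∈ stdSimplex ℝ (Finset (Fin L)), policyRegion rate p

/-- The number of feedback bits `B(δ) = -(L-1) log₂ δ + (L-1) log₂ (L (1 + L θ) (1 + θ/P))`. -/
def feedbackBits (L : ℕ) (θ P δ : ℝ) : ℝ :=
  -((L : ℝ) - 1) * Real.logb 2 δ
    + ((L : ℝ) - 1) * Real.logb 2 ((L : ℝ) * (1 + (L : ℝ) * θ) * (1 + θ / P))

end SDMA

end

/-!
Every departure rate is compared with one Gaussian tail probability. Let `k` queues be scheduled,
let `W` be the orthogonal complement of the interference space of queue `l`, put `t = k θ / P`, and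
let `F n ε` be the probability that `∑ i < n, |z i|² - ε ∑ i, |z i|² ≥ t` for i.i.d. `CN(0,1)`
variables `z i` (`energyTail`, with the index set `{i | i < n}`).

The Gaussian channel law is invariant under unitary maps (its characteristic function depends only
on the norm), so for a Gaussian vector `v` independent of `W` the probability of
`‖P_W v‖² - ε ‖v‖² ≥ t` depends only on `n = dim W` (`channelLaw_proj`). Both the true channels and
the fed back vectors have laws that do not charge proper subspaces; hence they are almost surely
linearly independent and `n = L - (k - 1)` in both models (`measureReal_energy`). With perfect
feedback the SNR is `γ ‖P_W h_l‖²`, so `d(k) = F n 0`. With limited feedback the SINR is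
at most `γ ‖P_W h_l‖²` for the space `W` computed from the feedback, which is independent of `h_l`;
this gives `dhat(k) ≤ d(k)`.

For the lower bound let `τ = 2 ^ (-B / (L - 1))` and let `w` be the component of `h_l` orthogonal to
its quantization, so that `‖w‖² ≤ τ ‖h_l‖²`. The useful signal is at least `‖P_W h_l‖² - ‖w‖²`, a
loss quadratic in the quantization error, and each interferer contributes at most `‖w‖²`
(`le_sinr_of_le_energy`). So `dhat(k) ≥ F n ε` with `ε = τ (1 + (k - 1) θ)`. Since `|z|²`
is exponentially distributed, raising the threshold by `c` costs at most the proportion `c` of a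
tail probability, even for a random `c` that does not involve one of the coordinates of the energy
(`pi_tail_le`). Here `c = ε (t + Y) / (1 - ε)`, where `Y` is the energy of the other `k - 1`
coordinates, of mean `k - 1` and independent of the rest; the number of feedback bits is such that
the mean of `c` is at most `δ` (`energyTail_ge`, `LimitedFeedbackModel.le_limitedRate`).
-/

noncomputable section

namespace SDMA

/-! ### The complex Gaussian law -/

lemma measurable_complex_mk : Measurable fun p : ℝ × ℝ => (⟨p.1, p.2⟩ : ℂ) :=
  Complex.measurableEquivRealProd.symm.measurable

instance : IsProbabilityMeasure complexGaussian :=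
  Measure.isProbabilityMeasure_map measurable_complex_mk.aemeasurable

instance (L : ℕ) : IsProbabilityMeasure (channelLaw L) :=
  Measure.isProbabilityMeasure_map (MeasurableEquiv.toLp 2 _).measurable.aemeasurable

lemma charFun_complexGaussian (t : ℂ) :
    charFun complexGaussian t = Complex.exp (-(‖t‖ ^ 2 / 4 : ℝ)) := by
  have h1 : ∀ p : ℝ × ℝ, Complex.exp (inner ℝ (⟨p.1, p.2⟩ : ℂ) t * Complex.I)
      = Complex.exp (inner ℝ p.1 t.re * Complex.I) *
        Complex.exp (inner ℝ p.2 t.im * Complex.I) := by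
    intro p
    rw [← Complex.exp_add]
    congr 1
    rw [Complex.inner]
    simp
    ring
  rw [charFun_apply, complexGaussian, integral_map measurable_complex_mk.aemeasurable
    (by fun_prop)]
  simp_rw [h1]
  rw [integral_prod_mul (fun x : ℝ => Complex.exp (inner ℝ x t.re * Complex.I))
    (fun x : ℝ => Complex.exp (inner ℝ x t.im * Complex.I)), ← charFun_apply, ← charFun_apply,
    charFun_gaussianReal, charFun_gaussianReal, ← Complex.exp_add]
  congr 1
  rw [← Complex.normSq_eq_norm_sq, Complex.normSq_apply]
  simp
  ring

lemma charFun_channelLaw (L : ℕ) (t : ChannelSpace L) :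
    charFun (channelLaw L) t = Complex.exp (-(‖t‖ ^ 2 / 4 : ℝ)) := by
  rw [channelLaw, charFun_pi]
  simp_rw [charFun_complexGaussian]
  rw [← Complex.exp_sum, EuclideanSpace.norm_sq_eq]
  congr 1
  push_cast
  rw [Finset.sum_neg_distrib, Finset.sum_div]

/-- The i.i.d. complex Gaussian law is invariant under unitary maps. -/
lemma channelLaw_map_isometry (L : ℕ) (U : ChannelSpace L ≃ₗᵢ[ℂ] ChannelSpace L) :
    (channelLaw L).map U = channelLaw L := by
  have hU : Measurable U := U.continuous.measurable
  have : IsProbabilityMeasure ((channelLaw L).map U) :=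
    Measure.isProbabilityMeasure_map hU.aemeasurable
  refine Measure.ext_of_charFun (funext fun t => ?_)
  have h1 : ∀ x, inner ℝ (U x) t = inner ℝ x (U.symm t) := by
    intro x
    have h2 : ‖U x + t‖ = ‖x + U.symm t‖ := by
      rw [← U.norm_map (x + U.symm t), map_add, U.apply_symm_apply]
    simp only [real_inner_eq_norm_add_mul_self_sub_norm_mul_self_sub_norm_mul_self_div_two, h2,
      U.norm_map, U.symm.norm_map]
  rw [charFun_apply, integral_map hU.aemeasurable (by fun_prop)]
  simp_rw [h1]
  rw [← charFun_apply, charFun_channelLaw, charFun_channelLaw, U.symm.norm_map]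

/-- In any orthonormal basis, the coordinates of a channel vector are i.i.d. `CN(0,1)`. -/
lemma channelLaw_map_coord (L : ℕ) (b : OrthonormalBasis (Fin L) ℂ (ChannelSpace L)) :
    (channelLaw L).map (fun v i => inner ℂ (b i) v) = Measure.pi fun _ => complexGaussian := by
  have h1 : (fun (v : ChannelSpace L) i => inner ℂ (b i) v)
      = (MeasurableEquiv.toLp 2 (Fin L → ℂ)).symm ∘ b.repr := by
    ext v i
    simp [b.repr_apply_apply]
  rw [h1, ← Measure.map_map (by fun_prop) b.repr.continuous.measurable,
    channelLaw_map_isometry, channelLaw, ← MeasurableEquiv.coe_toLp]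
  exact MeasurableEquiv.map_symm_map _

lemma lintegral_complexGaussian {f : ℂ → ENNReal} (hf : Measurable f) :
    ∫⁻ z, f z ∂complexGaussian
      = ∫⁻ z : ℂ, ENNReal.ofReal (Real.pi⁻¹ * Real.exp (-‖z‖ ^ 2)) * f z := by
  have hv : (1 / 2 : NNReal) ≠ 0 := by norm_num
  rw [complexGaussian, lintegral_map hf measurable_complex_mk,
    gaussianReal_of_var_ne_zero _ hv, prod_withDensity (by fun_prop) (by fun_prop),
    lintegral_withDensity_eq_lintegral_mul _ (by fun_prop)
      (show Measurable fun p : ℝ × ℝ => f ⟨p.1, p.2⟩ from hf.comp measurable_complex_mk),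
    ← Complex.volume_preserving_equiv_real_prod.symm.lintegral_comp_emb
      Complex.measurableEquivRealProd.symm.measurableEmbedding]
  refine lintegral_congr fun p => ?_
  have h2 : Complex.measurableEquivRealProd.symm p = (⟨p.1, p.2⟩ : ℂ) := rfl
  rw [h2]
  simp only [Pi.mul_apply, gaussianPDF]
  rw [← ENNReal.ofReal_mul (gaussianPDFReal_nonneg _ _ _)]
  congr 2
  rw [← Complex.normSq_eq_norm_sq, Complex.normSq_apply, gaussianPDFReal, gaussianPDFReal,
    mul_mul_mul_comm, ← Real.exp_add, ← mul_inv, Real.mul_self_sqrt (by positivity)]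
  congr 1
  · congr 1
    push_cast
    ring
  · congr 1
    push_cast
    ring

/-- The squared modulus of a `CN(0,1)` variable is exponentially distributed with rate `1`. -/
lemma complexGaussian_tail {u : ℝ} (hu : 0 ≤ u) :
    complexGaussian {z | u ≤ ‖z‖ ^ 2} = ENNReal.ofReal (Real.exp (-u)) := by
  have hS : MeasurableSet {z : ℂ | u ≤ ‖z‖ ^ 2} := measurableSet_le (by fun_prop) (by fun_prop)
  rw [← lintegral_indicator_one hS, lintegral_complexGaussian (measurable_one.indicator hS),
    ← Complex.lintegral_comp_polarCoord_symm, polarCoord_target, Measure.volume_eq_prod,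
    ← Measure.prod_restrict, lintegral_prod]
  · have h1 : ∀ r ∈ Set.Ioi (0:ℝ), ∫⁻ y in Set.Ioo (-Real.pi) Real.pi,
        ENNReal.ofReal (r, y).1 • (ENNReal.ofReal
          (Real.pi⁻¹ * Real.exp (-‖Complex.polarCoord.symm (r, y)‖ ^ 2)) *
          {z : ℂ | u ≤ ‖z‖ ^ 2}.indicator 1 (Complex.polarCoord.symm (r, y)))
        = (Set.Ici (√u)).indicator (fun r => ENNReal.ofReal (2 * r * Real.exp (-r ^ 2))) r := by
      intro r hr
      have hr : 0 < r := hr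
      have h2 : ∀ y : ℝ, {z : ℂ | u ≤ ‖z‖ ^ 2}.indicator (1 : ℂ → ENNReal)
          (Complex.polarCoord.symm (r, y)) = (Set.Ici (√u)).indicator 1 r := by
        intro y
        simp only [Set.indicator, Set.mem_ofPred_eq, Complex.norm_polarCoord_symm, sq_abs,
          Set.mem_Ici, Real.sqrt_le_left hr.le, Pi.one_apply]
      simp only [h2, Complex.norm_polarCoord_symm, sq_abs, smul_eq_mul, lintegral_const,
        Measure.restrict_apply_univ, Real.volume_Ioo]
      by_cases hm : r ∈ Set.Ici (√u)
      · simp only [Set.indicator_of_mem hm, Pi.one_apply, mul_one]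
        rw [← ENNReal.ofReal_mul hr.le, ← ENNReal.ofReal_mul (by positivity)]
        congr 1
        field_simp
        ring
      · simp [Set.indicator_of_notMem hm]
    rw [setLIntegral_congr_fun measurableSet_Ioi h1, setLIntegral_indicator measurableSet_Ici]
    have h3 : (Set.Ici (√u) ∩ Set.Ioi 0 : Set ℝ) =ᵐ[volume] Set.Ioi (√u) := by
      rcases (Real.sqrt_nonneg u).eq_or_lt with h0 | h0
      · rw [← h0]
        exact Filter.EventuallyEq.of_eq (Set.inter_eq_right.mpr Set.Ioi_subset_Ici_self)
      · have h4 : Set.Ici (√u) ⊆ Set.Ioi 0 := fun x hx => lt_of_lt_of_le h0 hx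
        rw [Set.inter_eq_left.mpr h4]
        exact Ioi_ae_eq_Ici.symm
    rw [setLIntegral_congr h3]
    have hd : ∀ x ∈ Set.Ici (√u), HasDerivAt (fun r : ℝ => -Real.exp (-r ^ 2))
        (2 * x * Real.exp (-x ^ 2)) x := by
      intro x _
      have h4 : HasDerivAt (fun r : ℝ => -r ^ 2) (-(2 * x)) x := by
        simpa using (hasDerivAt_pow 2 x).fun_neg
      refine h4.exp.fun_neg.congr_deriv ?_
      ring
    have hpos : ∀ x ∈ Set.Ioi (√u), 0 ≤ 2 * x * Real.exp (-x ^ 2) := by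
      intro x hx
      have : 0 ≤ x := (Real.sqrt_nonneg u).trans (le_of_lt hx)
      positivity
    have hlim : Filter.Tendsto (fun r : ℝ => -Real.exp (-r ^ 2)) Filter.atTop (nhds (-0)) := by
      refine Filter.Tendsto.neg (Real.tendsto_exp_atBot.comp ?_)
      exact Filter.tendsto_neg_atTop_atBot.comp (Filter.tendsto_pow_atTop (by norm_num))
    rw [← ofReal_integral_eq_lintegral_ofReal
      (integrableOn_Ioi_deriv_of_nonneg' hd hpos hlim)
      ((ae_restrict_iff' measurableSet_Ioi).mpr (Filter.Eventually.of_forall hpos)),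
      integral_Ioi_of_hasDerivAt_of_nonneg' hd hpos hlim]
    simp [Real.sq_sqrt hu]
  · have hm : Measurable (Complex.polarCoord.symm : ℝ × ℝ → ℂ) := by
      have : (Complex.polarCoord.symm : ℝ × ℝ → ℂ)
          = fun p => (p.1 : ℂ) * (Real.cos p.2 + Real.sin p.2 * Complex.I) := by
        ext p
        exact Complex.polarCoord_symm_apply p
      rw [this]
      fun_prop
    refine Measurable.aemeasurable ?_
    have hi : Measurable fun p => {z : ℂ | u ≤ ‖z‖ ^ 2}.indicator (1 : ℂ → ENNReal)
        (Complex.polarCoord.symm p) := (measurable_one.indicator hS).comp hm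
    fun_prop

/-- The exponential law has hazard rate at most `1` everywhere, including below its support. -/
lemma complexGaussian_tail_le (u : ℝ) {c : ℝ} (hc : 0 ≤ c) :
    complexGaussian {z | u ≤ ‖z‖ ^ 2} ≤
      complexGaussian {z | u + c ≤ ‖z‖ ^ 2}
        + ENNReal.ofReal c * complexGaussian {z | u ≤ ‖z‖ ^ 2} := by
  have hneg : ∀ v : ℝ, v ≤ 0 → complexGaussian {z | v ≤ ‖z‖ ^ 2} = 1 := by
    intro v hv
    rw [show {z : ℂ | v ≤ ‖z‖ ^ 2} = Set.univ from
      Set.eq_univ_of_forall fun z => hv.trans (by positivity), measure_univ]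
  have key : ∀ x y : ℝ, 0 < x → x ≤ 1 → x * Real.exp (-c) ≤ y →
      ENNReal.ofReal x ≤ ENNReal.ofReal y + ENNReal.ofReal c * ENNReal.ofReal x := by
    intro x y hx _ hy
    have h1 := Real.add_one_le_exp (-c)
    have hy0 : 0 ≤ y := le_trans (by positivity) hy
    rw [← ENNReal.ofReal_mul hc, ← ENNReal.ofReal_add hy0 (by positivity)]
    apply ENNReal.ofReal_le_ofReal
    nlinarith
  rcases le_total u 0 with hu | hu
  · rcases le_total (u + c) 0 with huc | huc
    · rw [hneg _ huc]
      exact prob_le_one.trans le_self_add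
    · rw [hneg _ hu, complexGaussian_tail huc, ← ENNReal.ofReal_one]
      refine key _ _ one_pos le_rfl ?_
      rw [one_mul]
      exact Real.exp_le_exp.mpr (by linarith)
  · rw [complexGaussian_tail hu, complexGaussian_tail (by linarith)]
    refine key _ _ (Real.exp_pos _) (Real.exp_le_one_iff.mpr (by linarith)) ?_
    rw [← Real.exp_add, neg_add]

lemma lintegral_sq_gaussianReal :
    ∫⁻ x, ENNReal.ofReal (x ^ 2) ∂(gaussianReal 0 (1 / 2)) = ENNReal.ofReal (1 / 2) := by
  have h := variance_id_gaussianReal (μ := 0) (v := 1 / 2)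
  rw [variance_of_integral_eq_zero measurable_id.aemeasurable (by simp)] at h
  rw [← ofReal_integral_eq_lintegral_ofReal]
  · simp only [id] at h
    rw [h]
    simp
  · exact (memLp_id_gaussianReal 2).integrable_sq
  · exact Filter.Eventually.of_forall fun x => sq_nonneg x

lemma lintegral_norm_sq_complexGaussian :
    ∫⁻ z, ENNReal.ofReal (‖z‖ ^ 2) ∂complexGaussian = 1 := by
  rw [complexGaussian, lintegral_map (by fun_prop) measurable_complex_mk]
  have h1 : ∀ p : ℝ × ℝ, ENNReal.ofReal (‖(⟨p.1, p.2⟩ : ℂ)‖ ^ 2)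
      = ENNReal.ofReal (p.1 ^ 2) + ENNReal.ofReal (p.2 ^ 2) := by
    intro p
    rw [← Complex.normSq_eq_norm_sq, Complex.normSq_apply,
      ← ENNReal.ofReal_add (by positivity) (by positivity)]
    congr 1
    ring
  simp_rw [h1]
  rw [lintegral_add_left (by fun_prop), lintegral_prod _ (by fun_prop),
    lintegral_prod_symm _ (by fun_prop)]
  simp only [lintegral_const, measure_univ, mul_one, lintegral_sq_gaussianReal]
  rw [← ENNReal.ofReal_add (by norm_num) (by norm_num)]
  norm_num

/-! ### Resampling one coordinate of a product measure -/

/-- Replacing one coordinate by an independent copy does not change an expectation. -/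
lemma lintegral_pi_resample {ι : Type*} [Fintype ι] [DecidableEq ι] {X : ι → Type*}
    [∀ i, MeasurableSpace (X i)] (ν : ∀ i, Measure (X i)) [∀ i, IsProbabilityMeasure (ν i)]
    (i : ι) {f : (∀ i, X i) → ENNReal} (hf : Measurable f) :
    ∫⁻ x, f x ∂Measure.pi ν = ∫⁻ x, ∫⁻ y, f (Function.update x i y) ∂ν i ∂Measure.pi ν := by
  refine lintegral_eq_of_lmarginal_eq {i} hf
    (by simpa only [lmarginal_singleton] using hf.lmarginal ν (s := {i})) ?_
  ext x
  have h1 : (fun x => ∫⁻ y, f (Function.update x i y) ∂ν i) = ∫⋯∫⁻_{i}, f ∂ν :=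
    (lmarginal_singleton f i).symm
  rw [h1, lmarginal_singleton (∫⋯∫⁻_{i}, f ∂ν)]
  simp [lmarginal_update_of_mem]

lemma lintegral_indicator_update {ι : Type*} [DecidableEq ι] {X : ι → Type*}
    [∀ i, MeasurableSpace (X i)] (i : ι) (ν : Measure (X i)) {S : Set (∀ i, X i)}
    (hS : MeasurableSet S) (x : ∀ i, X i) :
    ∫⁻ y, S.indicator 1 (Function.update x i y) ∂ν = ν {y | Function.update x i y ∈ S} := by
  have h1 : MeasurableSet {y | Function.update x i y ∈ S} := hS.preimage (measurable_update x)
  rw [← lintegral_indicator_one h1]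
  rfl

lemma measure_pi_resample {ι : Type*} [Fintype ι] [DecidableEq ι] {X : ι → Type*}
    [∀ i, MeasurableSpace (X i)] (ν : ∀ i, Measure (X i)) [∀ i, IsProbabilityMeasure (ν i)]
    (i : ι) {S : Set (∀ i, X i)} (hS : MeasurableSet S) :
    Measure.pi ν S = ∫⁻ x, ν i {y | Function.update x i y ∈ S} ∂Measure.pi ν := by
  rw [← lintegral_indicator_one hS, lintegral_pi_resample ν i (measurable_one.indicator hS)]
  exact lintegral_congr fun x => lintegral_indicator_update i (ν i) hS x

lemma measurable_measure_update {ι : Type*} [DecidableEq ι] {X : ι → Type*}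
    [∀ i, MeasurableSpace (X i)] (ν : ∀ i, Measure (X i)) [∀ i, IsProbabilityMeasure (ν i)]
    (i : ι) {S : Set (∀ i, X i)} (hS : MeasurableSet S) :
    Measurable fun x => ν i {y | Function.update x i y ∈ S} := by
  have h1 : Measurable (S.indicator (1 : (∀ i, X i) → ENNReal)) := measurable_one.indicator hS
  have h2 := h1.lmarginal ν (s := {i})
  rw [lmarginal_singleton] at h2
  simpa only [lintegral_indicator_update i (ν i) hS] using h2

/-! ### Gaussian tail comparison -/

section Comparison

variable {ι : Type*} [DecidableEq ι]

lemma sum_norm_sq_update_of_mem (S : Finset ι) {i : ι} (hi : i ∈ S) (x : ι → ℂ) (y : ℂ) :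
    ∑ j ∈ S, ‖Function.update x i y j‖ ^ 2 = ‖y‖ ^ 2 + ∑ j ∈ S.erase i, ‖x j‖ ^ 2 := by
  rw [← Finset.add_sum_erase _ _ hi, Function.update_self]
  congr 1
  refine Finset.sum_congr rfl fun j hj => ?_
  rw [Function.update_of_ne (Finset.ne_of_mem_erase hj)]

lemma sum_norm_sq_update_of_notMem (S : Finset ι) {i : ι} (hi : i ∉ S) (x : ι → ℂ) (y : ℂ) :
    ∑ j ∈ S, ‖Function.update x i y j‖ ^ 2 = ∑ j ∈ S, ‖x j‖ ^ 2 := by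
  refine Finset.sum_congr rfl fun j hj => ?_
  rw [Function.update_of_ne (ne_of_mem_of_not_mem hj hi)]

variable [Fintype ι]

/-- Raising the threshold of a Gaussian energy `∑ i ∈ S, |z i|²` by an amount `c` costs at most the
proportion `c` of the probability, even if `c` depends on the coordinates other than `i₀ ∈ S`:
the energy in the coordinate `i₀` is exponentially distributed. -/
lemma pi_tail_le (S : Finset ι) {i₀ : ι} (hi₀ : i₀ ∈ S) (t : ℝ) {c : (ι → ℂ) → ℝ}
    (hc : Measurable c) (hc0 : ∀ z, 0 ≤ c z) (hcu : ∀ z y, c (Function.update z i₀ y) = c z) :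
    (Measure.pi fun _ : ι => complexGaussian) {z | t ≤ ∑ i ∈ S, ‖z i‖ ^ 2} ≤
      (Measure.pi fun _ : ι => complexGaussian) {z | t + c z ≤ ∑ i ∈ S, ‖z i‖ ^ 2}
      + ∫⁻ z, ENNReal.ofReal (c z) * {z : ι → ℂ | t ≤ ∑ i ∈ S, ‖z i‖ ^ 2}.indicator 1 z
          ∂Measure.pi fun _ : ι => complexGaussian := by
  have hA : MeasurableSet {z : ι → ℂ | t ≤ ∑ i ∈ S, ‖z i‖ ^ 2} :=
    measurableSet_le (by fun_prop) (by fun_prop)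
  have hE : MeasurableSet {z : ι → ℂ | t + c z ≤ ∑ i ∈ S, ‖z i‖ ^ 2} :=
    measurableSet_le (by fun_prop) (by fun_prop)
  have hAi := (measurable_one : Measurable (1 : (ι → ℂ) → ENNReal)).indicator hA
  rw [measure_pi_resample _ i₀ hA, measure_pi_resample _ i₀ hE,
    lintegral_pi_resample _ i₀
      (f := fun z => ENNReal.ofReal (c z) * {z : ι → ℂ | t ≤ ∑ i ∈ S, ‖z i‖ ^ 2}.indicator 1 z)
      (by fun_prop),
    ← lintegral_add_left (measurable_measure_update (fun _ : ι => complexGaussian) i₀ hE)]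
  refine lintegral_mono fun x => ?_
  set R := ∑ j ∈ S.erase i₀, ‖x j‖ ^ 2 with hR
  have h1 : {y : ℂ | Function.update x i₀ y ∈ {z : ι → ℂ | t ≤ ∑ i ∈ S, ‖z i‖ ^ 2}}
      = {y | t - R ≤ ‖y‖ ^ 2} := by
    ext y
    simp only [Set.mem_ofPred_eq, sum_norm_sq_update_of_mem S hi₀, ← hR]
    exact sub_le_iff_le_add.symm
  have h2 : {y : ℂ | Function.update x i₀ y ∈ {z : ι → ℂ | t + c z ≤ ∑ i ∈ S, ‖z i‖ ^ 2}}
      = {y | t - R + c x ≤ ‖y‖ ^ 2} := by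
    ext y
    simp only [Set.mem_ofPred_eq, sum_norm_sq_update_of_mem S hi₀, ← hR, hcu]
    constructor <;> intro h <;> linarith
  have h3 : ∫⁻ y, ENNReal.ofReal (c (Function.update x i₀ y)) *
      {z : ι → ℂ | t ≤ ∑ i ∈ S, ‖z i‖ ^ 2}.indicator 1 (Function.update x i₀ y) ∂complexGaussian
      = ENNReal.ofReal (c x) * complexGaussian {y | t - R ≤ ‖y‖ ^ 2} := by
    simp only [hcu]
    rw [lintegral_const_mul' _ _ ENNReal.ofReal_ne_top,
      lintegral_indicator_update i₀ complexGaussian hA x, h1]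
  rw [h1, h2, h3]
  exact complexGaussian_tail_le _ (hc0 x)

/-- The energy of a coordinate outside `S` has mean `1` and is independent of the energy in `S`. -/
lemma lintegral_norm_sq_mul_indicator (S : Finset ι) {i : ι} (hi : i ∉ S) (t : ℝ) :
    ∫⁻ z, ENNReal.ofReal (‖z i‖ ^ 2) * {z : ι → ℂ | t ≤ ∑ i ∈ S, ‖z i‖ ^ 2}.indicator 1 z
        ∂(Measure.pi fun _ : ι => complexGaussian)
      = (Measure.pi fun _ : ι => complexGaussian) {z | t ≤ ∑ i ∈ S, ‖z i‖ ^ 2} := by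
  have hA : MeasurableSet {z : ι → ℂ | t ≤ ∑ i ∈ S, ‖z i‖ ^ 2} :=
    measurableSet_le (by fun_prop) (by fun_prop)
  have hAi := (measurable_one : Measurable (1 : (ι → ℂ) → ENNReal)).indicator hA
  rw [lintegral_pi_resample _ i
      (f := fun z => ENNReal.ofReal (‖z i‖ ^ 2) *
        {z : ι → ℂ | t ≤ ∑ i ∈ S, ‖z i‖ ^ 2}.indicator 1 z) (by fun_prop),
    ← lintegral_indicator_one hA]
  refine lintegral_congr fun x => ?_
  simp only [Function.update_self, Set.indicator, Set.mem_ofPred_eq,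
    sum_norm_sq_update_of_notMem S hi, Pi.one_apply]
  rw [lintegral_mul_const _ (by fun_prop), lintegral_norm_sq_complexGaussian, one_mul]

/-- Tail of a Gaussian energy `∑ i ∈ S, |z i|²` after subtraction of a small proportion `ε` of the
total energy. -/
def energyTail (S : Finset ι) (ε t : ℝ) : ℝ :=
  (Measure.pi fun _ : ι => complexGaussian).real
    {z | t ≤ ∑ i ∈ S, ‖z i‖ ^ 2 - ε * ∑ i, ‖z i‖ ^ 2}

lemma exp_neg_abs_le_energyTail {S : Finset ι} (hS : S.Nonempty) (t : ℝ) :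
    Real.exp (-|t|) ≤ energyTail S 0 t := by
  obtain ⟨i₀, hi₀⟩ := hS
  -- the coordinate `i₀` alone exceeds the threshold with probability `exp (-|t|)`
  have hA : MeasurableSet {z : ι → ℂ | |t| ≤ ‖z i₀‖ ^ 2} :=
    measurableSet_le (by fun_prop) (by fun_prop)
  have h1 : (Measure.pi fun _ : ι => complexGaussian) {z | |t| ≤ ‖z i₀‖ ^ 2}
      = ENNReal.ofReal (Real.exp (-|t|)) := by
    rw [measure_pi_resample _ i₀ hA]
    simp [complexGaussian_tail (abs_nonneg t)]
  have h2 : {z : ι → ℂ | |t| ≤ ‖z i₀‖ ^ 2}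
      ⊆ {z | t ≤ ∑ i ∈ S, ‖z i‖ ^ 2 - 0 * ∑ i, ‖z i‖ ^ 2} := by
    intro z hz
    have h3 := Finset.single_le_sum (f := fun i => ‖z i‖ ^ 2) (fun i _ => by positivity) hi₀
    have hz : |t| ≤ ‖z i₀‖ ^ 2 := hz
    show t ≤ _
    have := le_abs_self t
    linarith
  rw [energyTail, measureReal_def, ← ENNReal.ofReal_le_iff_le_toReal (measure_ne_top _ _), ← h1]
  exact measure_mono h2

lemma energyTail_pos {S : Finset ι} (hS : S.Nonempty) (t : ℝ) : 0 < energyTail S 0 t :=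
  (Real.exp_pos _).trans_le (exp_neg_abs_le_energyTail hS t)

/-- Subtracting the proportion `ε` of the total energy costs at most the proportion
`ε (t + |Sᶜ|) / (1 - ε)` of the tail probability. -/
lemma energyTail_ge {S : Finset ι} (hS : S.Nonempty) {ε t : ℝ} (hε : 0 ≤ ε) (hε1 : ε < 1)
    (ht : 0 ≤ t) :
    (1 - ε / (1 - ε) * (t + (Sᶜ.card : ℝ))) * energyTail S 0 t ≤ energyTail S ε t := by
  obtain ⟨i₀, hi₀⟩ := hS
  have h1ε : 0 < 1 - ε := by linarith
  have hr : 0 ≤ ε / (1 - ε) := div_nonneg hε h1ε.le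
  set r := ε / (1 - ε) with hrdef
  set ν := Measure.pi fun _ : ι => complexGaussian with hν
  set A := {z : ι → ℂ | t ≤ ∑ i ∈ S, ‖z i‖ ^ 2} with hAdef
  have hA : MeasurableSet A := measurableSet_le (by fun_prop) (by fun_prop)
  have hAi := (measurable_one : Measurable (1 : (ι → ℂ) → ENNReal)).indicator hA
  set c : (ι → ℂ) → ℝ := fun z => r * (t + ∑ i ∈ Sᶜ, ‖z i‖ ^ 2) with hc
  have key := pi_tail_le S hi₀ t (c := c) (by fun_prop) (fun z => by positivity) (by
    intro z y
    simp only [hc, sum_norm_sq_update_of_notMem Sᶜ (by simpa using hi₀)])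
  have hE : {z : ι → ℂ | t + c z ≤ ∑ i ∈ S, ‖z i‖ ^ 2}
      = {z | t ≤ ∑ i ∈ S, ‖z i‖ ^ 2 - ε * ∑ i, ‖z i‖ ^ 2} := by
    ext z
    simp only [Set.mem_ofPred_eq, hc, ← Finset.sum_add_sum_compl S, hrdef]
    rw [div_mul_eq_mul_div, ← le_sub_iff_add_le', div_le_iff₀ h1ε]
    constructor <;> intro h <;> linarith
  have hI : ∫⁻ z, ENNReal.ofReal (c z) * A.indicator 1 z ∂ν
      = ENNReal.ofReal (r * (t + (Sᶜ.card : ℝ))) * ν A := by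
    have h2 : ∀ z : ι → ℂ, ENNReal.ofReal (c z) * A.indicator 1 z
        = ENNReal.ofReal r * (ENNReal.ofReal t * A.indicator 1 z
          + ∑ i ∈ Sᶜ, ENNReal.ofReal (‖z i‖ ^ 2) * A.indicator 1 z) := by
      intro z
      simp only [hc]
      rw [ENNReal.ofReal_mul hr, ENNReal.ofReal_add ht (by positivity),
        ENNReal.ofReal_sum_of_nonneg (fun i _ => by positivity), mul_assoc, add_mul,
        Finset.sum_mul]
    simp_rw [h2]
    rw [lintegral_const_mul _ (by fun_prop), lintegral_add_left (by fun_prop),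
      lintegral_const_mul _ hAi, lintegral_finsetSum _ (fun i _ => by fun_prop),
      lintegral_indicator_one hA, Finset.sum_congr rfl fun i hi =>
        lintegral_norm_sq_mul_indicator S (Finset.mem_compl.mp hi) t, Finset.sum_const,
      ENNReal.ofReal_mul hr, ENNReal.ofReal_add ht (by positivity), ENNReal.ofReal_natCast,
      nsmul_eq_mul]
    ring
  rw [hE, hI] at key
  have h0 : energyTail S 0 t = ν.real A := by simp [energyTail, hAdef, hν]
  rw [h0]
  have key2 := ENNReal.toReal_mono (by finiteness) key
  rw [ENNReal.toReal_add (by finiteness) (by finiteness), ENNReal.toReal_mul,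
    ENNReal.toReal_ofReal (by positivity)] at key2
  change ν.real A ≤ energyTail S ε t + _ * ν.real A at key2
  linarith

end Comparison

/-! ### Gaussian energy in a random subspace -/

/-- The energy of a channel vector in a subspace depends only on the dimension. -/
lemma channelLaw_proj (L : ℕ) (W : Submodule ℂ (ChannelSpace L)) (ε t : ℝ) :
    (channelLaw L).real {v | t ≤ ‖W.starProjection v‖ ^ 2 - ε * ‖v‖ ^ 2}
      = energyTail (Finset.univ.filter fun i : Fin L => (i : ℕ) < Module.finrank ℂ W) ε t := by
  set n := Module.finrank ℂ W with hn
  have hnL : n ≤ L := by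
    have := Submodule.finrank_le W
    rwa [finrank_euclideanSpace_fin] at this
  let w := stdOrthonormalBasis ℂ W
  -- `b` is an orthonormal basis whose first `n` vectors span `W`
  let u : Fin L → ChannelSpace L :=
    fun i => if h : (i : ℕ) < n then (w ⟨i, h⟩ : ChannelSpace L) else 0
  have hu : Orthonormal ℂ (Set.domRestrict {i : Fin L | (i : ℕ) < n} u) := by
    have h1 : Orthonormal ℂ (fun i => (w i : ChannelSpace L)) :=
      w.orthonormal.comp_linearIsometry W.subtypeₗᵢ
    have h2 : Set.domRestrict {i : Fin L | (i : ℕ) < n} u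
        = (fun i => (w i : ChannelSpace L)) ∘ fun i => ⟨i.1.1, i.2⟩ := by
      ext1 i
      have := i.2
      simp only [Set.mem_ofPred_eq] at this
      simp [u, this]
    rw [h2]
    refine h1.comp _ fun i j hij => ?_
    simpa [Subtype.ext_iff, Fin.ext_iff] using hij
  obtain ⟨b, hb⟩ := hu.exists_orthonormalBasis_extension_of_card_eq (by simp)
  have hW : ∀ v, ‖W.starProjection v‖ ^ 2
      = ∑ i ∈ Finset.univ.filter fun i : Fin L => (i : ℕ) < n, ‖inner ℂ (b i) v‖ ^ 2 := by
    intro v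
    have h1 : ‖W.starProjection v‖ ^ 2 = ∑ j, ‖inner ℂ (w j : ChannelSpace L) v‖ ^ 2 := by
      rw [Submodule.starProjection_apply, ← Submodule.coe_norm, ← w.sum_sq_norm_inner_right]
      refine Finset.sum_congr rfl fun j _ => ?_
      rw [Submodule.coe_inner, ← Submodule.starProjection_apply,
        ← Submodule.inner_starProjection_left_eq_right,
        Submodule.starProjection_eq_self_iff.mpr (w j).2]
    rw [h1]
    refine Finset.sum_bij (fun j _ => ⟨j, j.2.trans_le hnL⟩) ?_ ?_ ?_ ?_
    · intro j _
      simp [hn]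
    · intro j _ k _ h
      simpa [Fin.ext_iff] using h
    · intro i hi
      exact ⟨⟨i, by simpa using hi⟩, Finset.mem_univ _, rfl⟩
    · intro j _
      rw [hb ⟨j, j.2.trans_le hnL⟩ j.2]
      simp [u, hn]
  have hm : Measurable fun (v : ChannelSpace L) i => inner ℂ (b i) v := by fun_prop
  have hS : MeasurableSet {z : Fin L → ℂ | t ≤ ∑ i ∈ Finset.univ.filter
      fun i : Fin L => (i : ℕ) < n, ‖z i‖ ^ 2 - ε * ∑ i, ‖z i‖ ^ 2} :=
    measurableSet_le (by fun_prop) (by fun_prop)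
  rw [energyTail, ← channelLaw_map_coord L b, map_measureReal_apply hm hS]
  congr 1
  ext v
  simp only [Set.mem_preimage, Set.mem_ofPred_eq, hW, b.sum_sq_norm_inner_right]

/-- The Gaussian law does not charge proper subspaces. -/
lemma channelLaw_submodule (L : ℕ) (K : Submodule ℂ (ChannelSpace L)) (hK : K ≠ ⊤) :
    channelLaw L K = 0 := by
  have hW : Kᗮ ≠ ⊥ := fun h => hK (Submodule.orthogonal_eq_bot_iff.mp h)
  have hn : 0 < Module.finrank ℂ Kᗮ := by
    rw [Nat.pos_iff_ne_zero]
    exact fun h => hW (Submodule.finrank_eq_zero.mp h)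
  have hnL : Module.finrank ℂ Kᗮ ≤ L := by
    have := Submodule.finrank_le Kᗮ
    rwa [finrank_euclideanSpace_fin] at this
  have hS : (Finset.univ.filter fun i : Fin L => (i : ℕ) < Module.finrank ℂ Kᗮ).Nonempty :=
    ⟨⟨0, hn.trans_le hnL⟩, by simpa using hn⟩
  -- on `K` the energy in `Kᗮ` vanishes, which has probability at most `1 - exp (-t) ≤ t`
  have hle : ∀ t : ℝ, 0 < t → (channelLaw L).real K ≤ 0 + t := by
    intro t ht
    have hm : MeasurableSet {v : ChannelSpace L | t ≤ ‖Kᗮ.starProjection v‖ ^ 2 - 0 * ‖v‖ ^ 2} :=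
      measurableSet_le (by fun_prop) (by fun_prop)
    have h1 : (K : Set (ChannelSpace L))
        ⊆ {v | t ≤ ‖Kᗮ.starProjection v‖ ^ 2 - 0 * ‖v‖ ^ 2}ᶜ := by
      intro v hv
      have h2 : Kᗮ.starProjection v = 0 := by
        rw [Submodule.starProjection_orthogonal_val, Submodule.starProjection_eq_self_iff.mpr hv,
          sub_self]
      have h3 : ¬ t ≤ ‖Kᗮ.starProjection v‖ ^ 2 - 0 * ‖v‖ ^ 2 := by
        rw [h2]
        simpa using ht
      exact h3
    have h3 := exp_neg_abs_le_energyTail hS t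
    have h4 := Real.add_one_le_exp (-t)
    refine (measureReal_mono h1).trans ?_
    rw [probReal_compl_eq_one_sub hm, channelLaw_proj]
    rw [abs_of_pos ht] at h3
    linarith
  have h0 := le_antisymm (le_of_forall_pos_le_add hle) measureReal_nonneg
  rwa [measureReal_eq_zero_iff] at h0

section RandomSubspace

variable {L : ℕ}

lemma norm_starProjection_orthogonal_le (K : Submodule ℂ (ChannelSpace L))
    (v : ChannelSpace L) {w : ChannelSpace L} (hw : w ∈ K) :
    ‖Kᗮ.starProjection v‖ ≤ ‖v - w‖ := by
  have h1 : Kᗮ.starProjection w = 0 := by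
    rw [Submodule.starProjection_orthogonal_val, Submodule.starProjection_eq_self_iff.mpr hw,
      sub_self]
  calc ‖Kᗮ.starProjection v‖ = ‖Kᗮ.starProjection (v - w)‖ := by rw [map_sub, h1, sub_zero]
    _ ≤ ‖v - w‖ := Submodule.norm_starProjection_apply_le _ _

lemma norm_starProjection_orthogonal_lt_iff (K : Submodule ℂ (ChannelSpace L))
    (v : ChannelSpace L) (r : ℝ) :
    ‖Kᗮ.starProjection v‖ < r ↔ ∃ w ∈ K, ‖v - w‖ < r := by
  constructor
  · intro h
    refine ⟨K.starProjection v, K.starProjection_apply_mem v, ?_⟩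
    rwa [← Submodule.starProjection_orthogonal_val]
  · rintro ⟨w, hw, h⟩
    exact (norm_starProjection_orthogonal_le K v hw).trans_lt h

/-- The distance of `x l` to the span of the vectors `x m`, `m ∈ S`, is an infimum of continuous
functions of the family `x`. -/
lemma measurable_norm_starProjection_span (S : Finset (Fin L)) (l : Fin L) :
    Measurable fun x : Fin L → ChannelSpace L =>
      ‖(Submodule.span ℂ (x '' (S : Set (Fin L))))ᗮ.starProjection (x l)‖ := by
  refine measurable_of_Iio fun r => IsOpen.measurableSet ?_
  have h1 : (fun x : Fin L → ChannelSpace L =>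
      ‖(Submodule.span ℂ (x '' (S : Set (Fin L))))ᗮ.starProjection (x l)‖) ⁻¹' Set.Iio r
      = ⋃ a : Fin L → ℂ, {x | ‖x l - ∑ m ∈ S, a m • x m‖ < r} := by
    ext x
    simp only [Set.mem_preimage, Set.mem_Iio, norm_starProjection_orthogonal_lt_iff,
      Submodule.mem_span_image_finset_iff_exists_fun', Set.mem_iUnion, Set.mem_ofPred_eq]
    constructor
    · rintro ⟨w, ⟨a, rfl⟩, h⟩
      exact ⟨a, h⟩
    · rintro ⟨a, h⟩
      exact ⟨_, ⟨a, rfl⟩, h⟩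
  rw [h1]
  exact isOpen_iUnion fun a => isOpen_lt (by fun_prop) continuous_const

lemma span_image_update (S : Finset (Fin L)) {l : Fin L} (hl : l ∉ S)
    (x : Fin L → ChannelSpace L) (y : ChannelSpace L) :
    Submodule.span ℂ (Function.update x l y '' (S : Set (Fin L)))
      = Submodule.span ℂ (x '' (S : Set (Fin L))) := by
  congr 1
  refine Set.image_congr fun m hm => ?_
  exact Function.update_of_ne (ne_of_mem_of_not_mem hm hl) _ _

/-- Independent vectors whose laws do not charge proper subspaces are almost surely linearly
independent, as long as there are at most `L` of them. -/
lemma ae_linearIndepOn (ν : Fin L → Measure (ChannelSpace L)) [∀ m, IsProbabilityMeasure (ν m)]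
    (S : Finset (Fin L))
    (hν : ∀ m ∈ S, ∀ K : Submodule ℂ (ChannelSpace L), K ≠ ⊤ → ν m K = 0) :
    ∀ᵐ x ∂Measure.pi ν, LinearIndepOn ℂ x (S : Set (Fin L)) := by
  induction S using Finset.induction_on with
  | empty => simp
  | insert m S hm ih =>
    have hset : MeasurableSet {x : Fin L → ChannelSpace L |
        ‖(Submodule.span ℂ (x '' (S : Set (Fin L))))ᗮ.starProjection (x m)‖ = 0} :=
      measurable_norm_starProjection_span S m (measurableSet_singleton 0)
    have h0 : Measure.pi ν {x : Fin L → ChannelSpace L |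
        ‖(Submodule.span ℂ (x '' (S : Set (Fin L))))ᗮ.starProjection (x m)‖ = 0} = 0 := by
      rw [measure_pi_resample ν m hset]
      refine (lintegral_congr fun x => ?_).trans lintegral_zero
      simp only [Set.mem_ofPred_eq, span_image_update S hm, Function.update_self, norm_eq_zero,
        Submodule.starProjection_apply_eq_zero_iff, Submodule.orthogonal_orthogonal]
      refine hν m (Finset.mem_insert_self m S)
        (Submodule.span ℂ (x '' (S : Set (Fin L)))) fun htop => ?_
      have h1 : Module.finrank ℂ (Submodule.span ℂ (x '' (S : Set (Fin L)))) ≤ S.card := by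
        classical
        rw [← Finset.coe_image]
        exact (finrank_span_finset_le_card _).trans Finset.card_image_le
      rw [htop, finrank_top, finrank_euclideanSpace_fin] at h1
      have h2 := Finset.card_le_univ (insert m S)
      rw [Finset.card_insert_of_notMem hm, Fintype.card_fin] at h2
      omega
    filter_upwards [ih fun k hk => hν k (Finset.mem_insert_of_mem hk), compl_mem_ae_iff.mpr h0]
      with x hx hx0
    rw [Finset.coe_insert]
    refine hx.insert fun hmem => hx0 ?_
    rw [← Submodule.orthogonal_orthogonal (Submodule.span ℂ (x '' (S : Set (Fin L))))] at hmem
    simpa using (Submodule.starProjection_apply_eq_zero_iff _).mpr hmem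

/-- The energy of a Gaussian vector `x l` outside the span of `|S|` independent vectors is
distributed like the energy of `L - |S|` Gaussian coordinates. -/
lemma pi_energy_orthogonal (ν : Fin L → Measure (ChannelSpace L))
    [∀ m, IsProbabilityMeasure (ν m)] (S : Finset (Fin L)) {l : Fin L} (hl : l ∉ S)
    (hνl : ν l = channelLaw L)
    (hν : ∀ m ∈ S, ∀ K : Submodule ℂ (ChannelSpace L), K ≠ ⊤ → ν m K = 0) (ε t : ℝ) :
    (Measure.pi ν).real {x | t ≤
      ‖(Submodule.span ℂ (x '' (S : Set (Fin L))))ᗮ.starProjection (x l)‖ ^ 2 - ε * ‖x l‖ ^ 2}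
      = energyTail (Finset.univ.filter fun i : Fin L => (i : ℕ) < L - S.card) ε t := by
  have hset : MeasurableSet {x : Fin L → ChannelSpace L | t ≤
      ‖(Submodule.span ℂ (x '' (S : Set (Fin L))))ᗮ.starProjection (x l)‖ ^ 2
        - ε * ‖x l‖ ^ 2} := by
    have := measurable_norm_starProjection_span S l
    exact measurableSet_le measurable_const (by fun_prop)
  rw [measureReal_def, measure_pi_resample ν l hset]
  have h1 : ∀ᵐ x ∂Measure.pi ν, ν l {y | Function.update x l y ∈ {x : Fin L → ChannelSpace L | t ≤
      ‖(Submodule.span ℂ (x '' (S : Set (Fin L))))ᗮ.starProjection (x l)‖ ^ 2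
        - ε * ‖x l‖ ^ 2}} = ENNReal.ofReal
      (energyTail (Finset.univ.filter fun i : Fin L => (i : ℕ) < L - S.card) ε t) := by
    filter_upwards [ae_linearIndepOn ν S hν] with x hx
    simp only [span_image_update S hl, Function.update_self]
    have h2 : Module.finrank ℂ (Submodule.span ℂ (x '' (S : Set (Fin L)))) = S.card := by
      have := finrank_span_eq_card hx
      rw [Set.image_eq_range]
      simpa using this
    have h3 := Submodule.finrank_add_finrank_orthogonal
      (Submodule.span ℂ (x '' (S : Set (Fin L))))
    rw [h2, finrank_euclideanSpace_fin] at h3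
    have h4 := channelLaw_proj L (Submodule.span ℂ (x '' (S : Set (Fin L))))ᗮ ε t
    rw [show Module.finrank ℂ (Submodule.span ℂ (x '' (S : Set (Fin L))))ᗮ = L - S.card by omega]
      at h4
    rw [← h4, hνl, ofReal_measureReal]
  rw [lintegral_congr_ae h1, lintegral_const, measure_univ, mul_one,
    ENNReal.toReal_ofReal]
  exact measureReal_nonneg

end RandomSubspace

/-! ### Zero-forcing beams -/

section Beams

variable {L : ℕ}

lemma inner_eq_inner_starProjection (W : Submodule ℂ (ChannelSpace L)) {g : ChannelSpace L}
    (hg : g ∈ W) (v : ChannelSpace L) : inner ℂ g v = inner ℂ g (W.starProjection v) := by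
  rw [← Submodule.inner_starProjection_left_eq_right, Submodule.starProjection_eq_self_iff.mpr hg]

lemma interferenceSpace_eq_span_image (A : Finset (Fin L)) (c : Fin L → ChannelSpace L)
    (l : Fin L) :
    interferenceSpace A c l = Submodule.span ℂ (c '' (A.erase l : Finset (Fin L))) := by
  rw [interferenceSpace]
  congr 1
  ext x
  simp only [Set.mem_ofPred_eq, Set.mem_image, Finset.mem_coe, Finset.mem_erase]
  constructor
  · rintro ⟨m, hA, hl, h⟩
    exact ⟨m, ⟨hl, hA⟩, h⟩
  · rintro ⟨m, ⟨hl, hA⟩, h⟩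
    exact ⟨m, hA, hl, h⟩

lemma zfBeam_mem (A : Finset (Fin L)) (c : Fin L → ChannelSpace L) (l : Fin L) :
    zfBeam A c l ∈ (interferenceSpace A c l)ᗮ :=
  Submodule.smul_mem _ _ (Submodule.starProjection_apply_mem _ _)

lemma norm_zfBeam_le_one (A : Finset (Fin L)) (c : Fin L → ChannelSpace L) (l : Fin L) :
    ‖zfBeam A c l‖ ≤ 1 := by
  rw [zfBeam, norm_smul, Complex.norm_real, norm_inv, norm_norm]
  exact inv_mul_le_one

lemma norm_inner_zfBeam_le (A : Finset (Fin L)) (c : Fin L → ChannelSpace L) (l : Fin L)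
    (v : ChannelSpace L) : ‖inner ℂ (zfBeam A c l) v‖ ≤ ‖v‖ :=
  (norm_inner_le_norm _ _).trans
    (mul_le_of_le_one_left (norm_nonneg _) (norm_zfBeam_le_one A c l))

lemma snr_eq (P : ℝ) (A : Finset (Fin L)) (c : Fin L → ChannelSpace L) (l : Fin L) :
    snr P A c l = gam P A * ‖(interferenceSpace A c l)ᗮ.starProjection (c l)‖ ^ 2 := by
  rw [snr, inner_eq_inner_starProjection _ (zfBeam_mem A c l), zfBeam, inner_smul_left, norm_mul,
    RCLike.norm_conj, Complex.norm_real, norm_inv, norm_norm, inner_self_eq_norm_sq_to_K]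
  simp only [norm_pow, RCLike.norm_ofReal, abs_norm]
  congr 2
  generalize ‖(interferenceSpace A c l)ᗮ.starProjection (c l)‖ = x
  rcases eq_or_ne x 0 with rfl | h
  · simp
  · field_simp

lemma norm_sq_sub_inner_smul {s : ChannelSpace L} (hs : ‖s‖ = 1) (v : ChannelSpace L) :
    ‖v - inner ℂ s v • s‖ ^ 2 = ‖v‖ ^ 2 - ‖inner ℂ s v‖ ^ 2 := by
  have h1 := Submodule.norm_sq_eq_add_norm_sq_starProjection v (Submodule.span ℂ {s})
  rw [Submodule.starProjection_orthogonal_val, Submodule.starProjection_unit_singleton ℂ hs,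
    norm_smul, hs, mul_one] at h1
  linarith

/-- The beam computed from `s` instead of `v` loses at most the energy of the component of `v`
orthogonal to `s`: the loss of signal is quadratic in the quantization error. -/
lemma norm_sq_starProjection_le (A : Finset (Fin L)) (c : Fin L → ChannelSpace L) (l : Fin L)
    (v : ChannelSpace L) :
    ‖(interferenceSpace A c l)ᗮ.starProjection v‖ ^ 2
      ≤ ‖inner ℂ (zfBeam A c l) v‖ ^ 2 + ‖v - inner ℂ (c l) v • c l‖ ^ 2 := by
  rw [inner_eq_inner_starProjection _ (zfBeam_mem A c l), zfBeam, inner_smul_left, norm_mul,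
    RCLike.norm_conj, Complex.norm_real, norm_inv, norm_norm]
  set W := (interferenceSpace A c l)ᗮ
  set p := W.starProjection (c l)
  set q := W.starProjection v
  have h1 := Submodule.norm_sq_eq_add_norm_sq_starProjection q (Submodule.span ℂ {p})
  have h2 : ‖(Submodule.span ℂ {p}).starProjection q‖ = ‖p‖⁻¹ * ‖inner ℂ p q‖ := by
    rw [Submodule.starProjection_singleton, norm_smul, norm_div]
    rcases eq_or_ne ‖p‖ 0 with h | h
    · simp [h]
    · simp only [RCLike.norm_ofReal, abs_pow, abs_norm]
      field_simp
  have h3 : ‖(Submodule.span ℂ {p})ᗮ.starProjection q‖ ≤ ‖v - inner ℂ (c l) v • c l‖ := by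
    refine (norm_starProjection_orthogonal_le _ q (Submodule.smul_mem _ (inner ℂ (c l) v)
      (Submodule.mem_span_singleton_self p))).trans ?_
    have h4 : q - inner ℂ (c l) v • p = W.starProjection (v - inner ℂ (c l) v • c l) := by
      rw [map_sub, map_smul]
    rw [h4]
    exact Submodule.norm_starProjection_apply_le _ _
  rw [h1, h2]
  gcongr

/-- The interference caused by another beam comes only from the quantization error. -/
lemma norm_inner_zfBeam_sq_le {A : Finset (Fin L)} (c : Fin L → ChannelSpace L) {l m : Fin L}
    (hl : l ∈ A) (hlm : l ≠ m) (v : ChannelSpace L) :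
    ‖inner ℂ (zfBeam A c m) v‖ ^ 2 ≤ ‖v - inner ℂ (c l) v • c l‖ ^ 2 := by
  have h0 : c l ∈ interferenceSpace A c m := Submodule.subset_span ⟨l, hl, hlm, rfl⟩
  have h1 : inner ℂ (zfBeam A c m) (c l) = 0 :=
    Submodule.inner_left_of_mem_orthogonal h0 (zfBeam_mem A c m)
  have h2 : inner ℂ (zfBeam A c m) v
      = inner ℂ (zfBeam A c m) (v - inner ℂ (c l) v • c l) := by
    rw [inner_sub_right, inner_smul_right, h1, mul_zero, sub_zero]
  rw [h2]
  gcongr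
  exact norm_inner_zfBeam_le A c m _

lemma gam_pos {P : ℝ} (hP : 0 < P) {A : Finset (Fin L)} {l : Fin L} (hl : l ∈ A) :
    0 < gam P A :=
  div_pos hP (Nat.cast_pos.mpr (Finset.card_pos.mpr ⟨l, hl⟩))

lemma le_snr_iff {P θ : ℝ} (hP : 0 < P) {A : Finset (Fin L)} {l : Fin L} (hl : l ∈ A)
    (c : Fin L → ChannelSpace L) :
    θ ≤ snr P A c l ↔
      θ / gam P A ≤ ‖(interferenceSpace A c l)ᗮ.starProjection (c l)‖ ^ 2 - 0 * ‖c l‖ ^ 2 := by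
  rw [snr_eq, zero_mul, sub_zero, div_le_iff₀' (gam_pos hP hl)]

lemma le_energy_of_le_sinr {P θ : ℝ} (hP : 0 < P) {A : Finset (Fin L)} {l : Fin L}
    (hl : l ∈ A) (v c : Fin L → ChannelSpace L) (h : θ ≤ sinr P A v c l) :
    θ / gam P A ≤ ‖(interferenceSpace A c l)ᗮ.starProjection (v l)‖ ^ 2 - 0 * ‖v l‖ ^ 2 := by
  have hg := gam_pos hP hl
  rw [zero_mul, sub_zero, div_le_iff₀' hg]
  refine h.trans ((div_le_self (by positivity) ?_).trans ?_)
  · exact le_add_of_nonneg_right (by positivity)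
  · gcongr
    rw [inner_eq_inner_starProjection _ (zfBeam_mem A c l)]
    exact norm_inner_zfBeam_le A c l _

/-- If the quantization error is at most `τ`, the SINR condition holds as soon as the energy outside
the interference space exceeds the noise threshold by the margin `τ (1 + (k - 1) θ) ‖v l‖²`, which
pays for the loss of signal and for the `k - 1` interferers. -/
lemma le_sinr_of_le_energy {P θ τ : ℝ} (hP : 0 < P) (hθ : 0 < θ) {A : Finset (Fin L)}
    {l : Fin L} (hl : l ∈ A) (v c : Fin L → ChannelSpace L) (hc : ‖c l‖ = 1)
    (hcap : (1 - τ) * ‖v l‖ ^ 2 ≤ ‖inner ℂ (c l) (v l)‖ ^ 2)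
    (h : θ / gam P A ≤ ‖(interferenceSpace A c l)ᗮ.starProjection (v l)‖ ^ 2
      - τ * (1 + ((A.card : ℝ) - 1) * θ) * ‖v l‖ ^ 2) :
    θ ≤ sinr P A v c l := by
  have hg := gam_pos hP hl
  have he : ‖v l - inner ℂ (c l) (v l) • c l‖ ^ 2 ≤ τ * ‖v l‖ ^ 2 := by
    rw [norm_sq_sub_inner_smul hc]
    linarith
  have hs := norm_sq_starProjection_le A c l (v l)
  have hi : ∑ m ∈ A.erase l, ‖inner ℂ (zfBeam A c m) (v l)‖ ^ 2
      ≤ ((A.card : ℝ) - 1) * (τ * ‖v l‖ ^ 2) := by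
    have h1 : ∀ m ∈ A.erase l, ‖inner ℂ (zfBeam A c m) (v l)‖ ^ 2 ≤ τ * ‖v l‖ ^ 2 := fun m hm =>
      (norm_inner_zfBeam_sq_le c hl (Finset.ne_of_mem_erase hm).symm (v l)).trans he
    have h2 := Finset.sum_le_card_nsmul _ _ _ h1
    rwa [Finset.card_erase_of_mem hl, nsmul_eq_mul,
      Nat.cast_pred (Finset.card_pos.mpr ⟨l, hl⟩)] at h2
  have hden : 0 < 1 + gam P A * ∑ m ∈ A.erase l, ‖inner ℂ (zfBeam A c m) (v l)‖ ^ 2 :=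
    add_pos_of_pos_of_nonneg one_pos
      (mul_nonneg hg.le (Finset.sum_nonneg fun m _ => sq_nonneg _))
  rw [sinr, le_div_iff₀ hden]
  rw [div_le_iff₀' hg] at h
  have h1 : θ * (gam P A * ∑ m ∈ A.erase l, ‖inner ℂ (zfBeam A c m) (v l)‖ ^ 2)
      ≤ θ * (gam P A * (((A.card : ℝ) - 1) * (τ * ‖v l‖ ^ 2))) := by gcongr
  have h2 : gam P A * ‖(interferenceSpace A c l)ᗮ.starProjection (v l)‖ ^ 2
      ≤ gam P A * (‖inner ℂ (zfBeam A c l) (v l)‖ ^ 2 + τ * ‖v l‖ ^ 2) := by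
    gcongr
    linarith
  linarith

end Beams

/-! ### The feedback model -/

section Model

variable {L : ℕ}

lemma sphereMeasure_submodule (K : Submodule ℂ (ChannelSpace L)) (hK : K ≠ ⊤) :
    sphereMeasure L K = 0 := by
  have hm : MeasurableSet (K : Set (ChannelSpace L)) := K.closed_of_finiteDimensional.measurableSet
  rw [sphereMeasure, Measure.map_apply measurable_subtype_coe hm,
    Measure.toSphere_apply' _ (measurable_subtype_coe hm)]
  refine mul_eq_zero_of_right _ (measure_mono_null ?_
    (Measure.addHaar_submodule volume (K.restrictScalars ℝ) (by simpa using hK)))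
  rintro _ ⟨r, -, x, ⟨y, hy, rfl⟩, rfl⟩
  exact (K.restrictScalars ℝ).smul_mem r hy

lemma measurableSet_cap (B : ℝ) (v : ChannelSpace L) : MeasurableSet (cap B v) := by
  have h1 : MeasurableSet {s : ChannelSpace L | ‖s‖ = 1} :=
    measurableSet_eq_fun (by fun_prop) (by fun_prop)
  have h2 : MeasurableSet {s : ChannelSpace L |
      (1 - (2 : ℝ) ^ (-B / ((L : ℝ) - 1))) * ‖v‖ ^ 2 ≤ ‖inner ℂ s v‖ ^ 2} :=
    measurableSet_le (by fun_prop) (by fun_prop)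
  exact h1.inter h2

lemma measurableSet_mem_cap (B : ℝ) :
    MeasurableSet {x : ChannelSpace L × ChannelSpace L | x.2 ∈ cap B x.1} := by
  have h1 : MeasurableSet {x : ChannelSpace L × ChannelSpace L | ‖x.2‖ = 1} :=
    measurableSet_eq_fun (by fun_prop) (by fun_prop)
  have h2 : MeasurableSet {x : ChannelSpace L × ChannelSpace L |
      (1 - (2 : ℝ) ^ (-B / ((L : ℝ) - 1))) * ‖x.1‖ ^ 2 ≤ ‖inner ℂ x.2 x.1‖ ^ 2} :=
    measurableSet_le (by fun_prop) (by fun_prop)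
  exact h1.inter h2

variable {Ω : Type*} [MeasurableSpace Ω] {μ : Measure Ω} [IsProbabilityMeasure μ] {B : ℝ}
  {h hhat : Fin L → Ω → ChannelSpace L}

lemma LimitedFeedbackModel.ae_notMem (hmodel : LimitedFeedbackModel μ B h hhat) (l : Fin L)
    {T : Set (ChannelSpace L × ChannelSpace L)} (hT : MeasurableSet T)
    (hT0 : ∀ v, capUniform B v {s | (v, s) ∈ T} = 0) :
    ∀ᵐ ω ∂μ, (h l ω, hhat l ω) ∉ T := by
  have hh := (hmodel.hasLaw l).aemeasurable
  have h1 : (μ.map fun ω => (h l ω, hhat l ω)) T = 0 := by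
    rw [← compProd_map_condDistrib (hmodel.aemeasurable l), Measure.compProd_apply hT,
      (hmodel.hasLaw l).map_eq]
    refine (lintegral_congr_ae ?_).trans lintegral_zero
    filter_upwards [hmodel.condDistrib_eq l] with v hv
    rw [hv]
    exact hT0 v
  rw [Measure.map_apply_of_aemeasurable (hh.prodMk (hmodel.aemeasurable l)) hT] at h1
  exact compl_mem_ae_iff.mpr h1

lemma LimitedFeedbackModel.ae_mem_cap (hmodel : LimitedFeedbackModel μ B h hhat) (l : Fin L) :
    ∀ᵐ ω ∂μ, hhat l ω ∈ cap B (h l ω) := by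
  have h1 : ∀ v, capUniform B v {s | (v, s) ∈
      {x : ChannelSpace L × ChannelSpace L | x.2 ∈ cap B x.1}ᶜ} = 0 := by
    intro v
    change cond (sphereMeasure L) (cap B v) (cap B v)ᶜ = 0
    rw [cond_apply (measurableSet_cap B v), Set.inter_compl_self, measure_empty, mul_zero]
  filter_upwards [hmodel.ae_notMem l (measurableSet_mem_cap B).compl h1] with ω hω
  exact not_not.mp hω

lemma LimitedFeedbackModel.map_hhat_submodule (hmodel : LimitedFeedbackModel μ B h hhat)
    (l : Fin L) (K : Submodule ℂ (ChannelSpace L)) (hK : K ≠ ⊤) : μ.map (hhat l) K = 0 := by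
  have hm : MeasurableSet (K : Set (ChannelSpace L)) := K.closed_of_finiteDimensional.measurableSet
  rw [Measure.map_apply_of_aemeasurable (hmodel.aemeasurable l) hm]
  refine compl_mem_ae_iff.mp (hmodel.ae_notMem l (T := Prod.snd ⁻¹' K) (measurable_snd hm)
    fun v => ?_)
  exact cond_absolutelyContinuous (sphereMeasure_submodule K hK)

/-- If the vectors `c m` are independent, `c l` is Gaussian and the laws of the other ones do not
charge proper subspaces, the energy of `c l` outside its interference space is distributed like the
energy of `L - (k - 1)` Gaussian coordinates. -/
lemma measureReal_energy {c : Fin L → Ω → ChannelSpace L} (hc : ∀ m, AEMeasurable (c m) μ)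
    (hind : iIndepFun c μ) {A : Finset (Fin L)} {l : Fin L} (hl : l ∈ A)
    (hcl : μ.map (c l) = channelLaw L)
    (hnull : ∀ m, m ≠ l → ∀ K : Submodule ℂ (ChannelSpace L), K ≠ ⊤ → μ.map (c m) K = 0)
    (ε t : ℝ) :
    μ.real {ω | t ≤ ‖(interferenceSpace A (fun m => c m ω) l)ᗮ.starProjection (c l ω)‖ ^ 2
        - ε * ‖c l ω‖ ^ 2}
      = energyTail (Finset.univ.filter fun i : Fin L => (i : ℕ) < L - (A.card - 1)) ε t := by
  have hprob : ∀ m, IsProbabilityMeasure (μ.map (c m)) := fun m =>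
    Measure.isProbabilityMeasure_map (hc m)
  have h1 := pi_energy_orthogonal (fun m => μ.map (c m)) (A.erase l) (Finset.notMem_erase l A) hcl
    (fun m hm => hnull m (Finset.ne_of_mem_erase hm)) ε t
  rw [Finset.card_erase_of_mem hl] at h1
  rw [← h1, ← (iIndepFun_iff_map_fun_eq_pi_map hc).mp hind, measureReal_def, measureReal_def,
    Measure.map_apply_of_aemeasurable (aemeasurable_pi_lambda _ hc)]
  · simp only [interferenceSpace_eq_span_image]
    rfl
  · have := measurable_norm_starProjection_span (A.erase l) l
    exact measurableSet_le measurable_const (by fun_prop)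

lemma LimitedFeedbackModel.perfectRate_eq (hmodel : LimitedFeedbackModel μ B h hhat) {P : ℝ}
    (hP : 0 < P) (θ : ℝ) {A : Finset (Fin L)} {l : Fin L} (hl : l ∈ A) :
    perfectRate μ h P θ A l = energyTail
      (Finset.univ.filter fun i : Fin L => (i : ℕ) < L - (A.card - 1)) 0 (θ / gam P A) := by
  rw [perfectRate, if_pos hl]
  simp only [le_snr_iff hP hl]
  refine measureReal_energy (fun m => (hmodel.hasLaw m).aemeasurable) ?_ hl
    (hmodel.hasLaw l).map_eq (fun m _ K hK => ?_) 0 _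
  · exact hmodel.indep.comp (fun _ => Prod.fst) fun _ => measurable_fst
  · rw [(hmodel.hasLaw m).map_eq]
    exact channelLaw_submodule L K hK

/-- The true channel of mobile `l` is independent of the feedback of the other mobiles, so its
energy outside the interference space computed from the feedback has the same law as with perfect
feedback. -/
lemma LimitedFeedbackModel.measureReal_energy_hhat (hmodel : LimitedFeedbackModel μ B h hhat)
    {A : Finset (Fin L)} {l : Fin L} (hl : l ∈ A) (ε t : ℝ) :
    μ.real {ω | t ≤ ‖(interferenceSpace A (fun m => hhat m ω) l)ᗮ.starProjection (h l ω)‖ ^ 2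
        - ε * ‖h l ω‖ ^ 2}
      = energyTail (Finset.univ.filter fun i : Fin L => (i : ℕ) < L - (A.card - 1)) ε t := by
  -- the true channel of `l` together with the fed back vectors of the others
  let c : Fin L → Ω → ChannelSpace L := fun m => if m = l then h m else hhat m
  have hcl : c l = h l := if_pos rfl
  have hcm : ∀ m, m ≠ l → c m = hhat m := fun m hm => if_neg hm
  have hspace : ∀ ω, interferenceSpace A (fun m => hhat m ω) l
      = interferenceSpace A (fun m => c m ω) l := by
    intro ω
    simp only [interferenceSpace_eq_span_image]
    congr 1
    refine Set.image_congr fun m hm => ?_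
    rw [hcm m (Finset.ne_of_mem_erase hm)]
  have hind : iIndepFun c μ := by
    have := hmodel.indep.comp (fun m x => if m = l then x.1 else x.2) fun m => by
      by_cases hm : m = l
      · simpa [hm] using measurable_fst
      · simpa [hm] using measurable_snd
    convert this using 2 with m
    ext1 ω
    by_cases hm : m = l <;> simp [c, hm]
  simp only [hspace, ← hcl]
  refine measureReal_energy (fun m => ?_) hind hl ?_ (fun m hm K hK => ?_) ε t
  · by_cases hm : m = l
    · rw [hm, hcl]
      exact (hmodel.hasLaw l).aemeasurable
    · rw [hcm m hm]
      exact hmodel.aemeasurable m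
  · rw [hcl, (hmodel.hasLaw l).map_eq]
  · rw [hcm m hm]
    exact hmodel.map_hhat_submodule m K hK

lemma LimitedFeedbackModel.limitedRate_le (hmodel : LimitedFeedbackModel μ B h hhat) {P : ℝ}
    (hP : 0 < P) (θ : ℝ) (A : Finset (Fin L)) (l : Fin L) :
    limitedRate μ h hhat P θ A l ≤ perfectRate μ h P θ A l := by
  by_cases hl : l ∈ A
  · rw [hmodel.perfectRate_eq hP θ hl, ← hmodel.measureReal_energy_hhat hl, limitedRate, if_pos hl]
    refine measureReal_mono fun ω hω => ?_
    exact le_energy_of_le_sinr hP hl (fun m => h m ω) (fun m => hhat m ω) hω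
  · simp [limitedRate, perfectRate, hl]

/-- The `B ≥ B(δ)` feedback bits make the relative quantization error at most
`δ / (L (1 + L θ) (1 + θ / P))`. -/
lemma two_rpow_mul_le {P θ δ : ℝ} (hL : 2 ≤ L) (hP : 0 < P) (hθ : 0 < θ) (hδ : 0 < δ)
    (hB : feedbackBits L θ P δ ≤ B) :
    (2 : ℝ) ^ (-B / ((L : ℝ) - 1)) * ((L : ℝ) * (1 + (L : ℝ) * θ) * (1 + θ / P)) ≤ δ := by
  have hL' : (2 : ℝ) ≤ L := by exact_mod_cast hL
  have hL1 : 0 < (L : ℝ) - 1 := by linarith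
  have hK : 0 < (L : ℝ) * (1 + (L : ℝ) * θ) * (1 + θ / P) := by positivity
  set K := (L : ℝ) * (1 + (L : ℝ) * θ) * (1 + θ / P) with hKdef
  rw [← le_div_iff₀ hK, ← Real.le_logb_iff_rpow_le one_lt_two (by positivity),
    Real.logb_div hδ.ne' hK.ne', div_le_iff₀ hL1]
  rw [feedbackBits, ← hKdef] at hB
  linarith

lemma LimitedFeedbackModel.le_limitedRate (hmodel : LimitedFeedbackModel μ B h hhat) (hL : 2 ≤ L)
    {P θ δ : ℝ} (hP : 0 < P) (hθ : 0 < θ) (hδ0 : 0 < δ) (hδ1 : δ < 1)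
    (hB : feedbackBits L θ P δ ≤ B) (A : Finset (Fin L)) (l : Fin L) :
    (1 - δ) * perfectRate μ h P θ A l ≤ limitedRate μ h hhat P θ A l := by
  by_cases hl : l ∈ A
  swap
  · simp [limitedRate, perfectRate, hl]
  set τ := (2 : ℝ) ^ (-B / ((L : ℝ) - 1)) with hτ
  set k : ℝ := (A.card : ℝ) with hk
  set r := θ / P with hr
  have hk1 : 1 ≤ A.card := Finset.card_pos.mpr ⟨l, hl⟩
  have hkL : A.card ≤ L := by simpa using Finset.card_le_univ A
  have hk1' : 1 ≤ k := by rw [hk]; exact_mod_cast hk1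
  have hkL' : k ≤ L := by rw [hk]; exact_mod_cast hkL
  have hr0 : 0 < r := div_pos hθ hP
  have hτ0 : 0 < τ := by positivity
  have hτδ := two_rpow_mul_le hL hP hθ hδ0 hB
  rw [← hτ, ← hr] at hτδ
  set ε := τ * (1 + (k - 1) * θ) with hε
  have hε0 : 0 ≤ ε := by
    have : 0 ≤ (k - 1) * θ := mul_nonneg (by linarith) hθ.le
    positivity
  have hεk : ε * (k * (1 + r)) ≤ δ := by
    refine le_trans ?_ hτδ
    have h1 : ε ≤ τ * (1 + L * θ) := by
      rw [hε]
      gcongr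
      linarith
    calc ε * (k * (1 + r)) ≤ τ * (1 + L * θ) * (L * (1 + r)) := by gcongr
      _ = _ := by ring
  have hε1 : ε < 1 := by
    have h1 : 1 ≤ k * (1 + r) := by nlinarith
    exact ((le_mul_of_one_le_right hε0 h1).trans hεk).trans_lt hδ1
  have ht : θ / gam P A = k * r := by
    rw [gam, ← hk, hr]
    field_simp
  set S := Finset.univ.filter fun i : Fin L => (i : ℕ) < L - (A.card - 1) with hS
  have hSne : S.Nonempty := ⟨⟨0, by omega⟩, by simp [hS]; omega⟩
  have hScard : (Sᶜ.card : ℝ) = k - 1 := by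
    have h1 : S.card = L - (A.card - 1) := by
      rw [hS, Fin.card_filter_val_lt]
      omega
    rw [Finset.card_compl, h1, Fintype.card_fin, hk, ← Nat.cast_pred hk1]
    congr 1
    omega
  have hcomp := energyTail_ge hSne hε0 hε1 (t := k * r) (by positivity)
  have hpos := energyTail_pos hSne (k * r)
  rw [hScard] at hcomp
  -- `k r + (k - 1) + δ ≤ k (1 + r)` leaves room for the denominator `1 - ε`
  have hloss : ε / (1 - ε) * (k * r + (k - 1)) ≤ δ := by
    rw [div_mul_eq_mul_div, div_le_iff₀ (by linarith)]
    nlinarith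
  have hlow : energyTail S ε (k * r) ≤ limitedRate μ h hhat P θ A l := by
    rw [← hmodel.measureReal_energy_hhat hl, limitedRate, if_pos hl, measureReal_def,
      measureReal_def]
    refine ENNReal.toReal_mono (measure_ne_top _ _) (measure_mono_ae ?_)
    filter_upwards [hmodel.ae_mem_cap l] with ω hω hE
    refine le_sinr_of_le_energy hP hθ hl (fun m => h m ω) (fun m => hhat m ω) hω.1 hω.2 ?_
    rw [ht]
    exact hE
  rw [hmodel.perfectRate_eq hP θ hl, ht]
  refine le_trans ?_ (hcomp.trans hlow)
  gcongr

end Model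

end SDMA

end

theorem theorem2 {Ω : Type*} [MeasurableSpace Ω] (μ : Measure Ω) [IsProbabilityMeasure μ]
    (L : ℕ) (hL : 2 ≤ L) (P θ δ B : ℝ) (hP : 0 < P) (hθ : 0 < θ) (hδ0 : 0 < δ) (hδ1 : δ < 1)
    (hB : SDMA.feedbackBits L θ P δ ≤ B)
    (h hhat : Fin L → Ω → SDMA.ChannelSpace L)
    (hmodel : SDMA.LimitedFeedbackModel μ B h hhat) :
    (∀ (A : Finset (Fin L)) (l : Fin L), l ∈ A →
      1 - SDMA.limitedRate μ h hhat P θ A l / SDMA.perfectRate μ h P θ A l ≤ δ) ∧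
    (1 - δ) • SDMA.stabilityRegion (SDMA.perfectRate μ h P θ) ⊆
      SDMA.stabilityRegion (SDMA.limitedRate μ h hhat P θ) ∧
    SDMA.stabilityRegion (SDMA.limitedRate μ h hhat P θ) ⊆
      SDMA.stabilityRegion (SDMA.perfectRate μ h P θ) := by
  have hlow := hmodel.le_limitedRate hL hP hθ hδ0 hδ1 hB
  refine ⟨fun A l hl => ?_, ?_, ?_⟩
  · have hkL : A.card ≤ L := by simpa using Finset.card_le_univ A
    have hpos : 0 < SDMA.perfectRate μ h P θ A l := by
      rw [hmodel.perfectRate_eq hP θ hl]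
      refine SDMA.energyTail_pos ⟨⟨0, by omega⟩, ?_⟩ _
      have := Finset.card_pos.mpr ⟨l, hl⟩
      simp only [Finset.mem_filter, Finset.mem_univ, true_and]
      omega
    rw [sub_le_comm, le_div_iff₀ hpos]
    exact hlow A l
  · rintro _ ⟨lam, hlam, rfl⟩
    simp only [SDMA.stabilityRegion, Set.mem_iUnion] at hlam ⊢
    obtain ⟨p, hp, h0, hle⟩ := hlam
    refine ⟨p, hp, fun l => mul_nonneg (by linarith) (h0 l), fun l => ?_⟩
    calc (1 - δ) * lam l ≤ (1 - δ) * SDMA.meanRate (SDMA.perfectRate μ h P θ) p l :=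
          mul_le_mul_of_nonneg_left (hle l) (by linarith)
      _ = ∑ A, p A * ((1 - δ) * SDMA.perfectRate μ h P θ A l) := by
          rw [SDMA.meanRate, Finset.mul_sum]
          exact Finset.sum_congr rfl fun A _ => by ring
      _ ≤ _ := Finset.sum_le_sum fun A _ => mul_le_mul_of_nonneg_left (hlow A l) (hp.1 A)
  · intro lam hlam
    simp only [SDMA.stabilityRegion, Set.mem_iUnion] at hlam ⊢
    obtain ⟨p, hp, h0, hle⟩ := hlam
    exact ⟨p, hp, h0, fun l => (hle l).trans (Finset.sum_le_sum fun A _ =>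
      mul_le_mul_of_nonneg_left (hmodel.limitedRate_le hP θ A l) (hp.1 A))⟩
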